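/- Let $d\ge 1$ be an integer, let $K\subset\mathbb{R}^d$ be a compact convex set with non-empty interior, and let $k>-1$ be real. For a set $M\subset\mathbb{R}^d$ with $0<\operatorname{vol}_p M<\infty$, where $\operatorname{vol}_p$ denotes $p$-dimensional volume, define the volumetric moment $$v_p^{(k)}(M)=\frac{\mathbb{E}\big[\Delta_p^{\,k}\big]}{(\operatorname{vol}_p M)^k},\qquad \Delta_p=\operatorname{vol}_p\operatorname{conv}(X_0,\ldots,X_p),$$ where $X_0,\ldots,X_p$ are independent and uniformly distributed in $M$ (with respect to $\operatorname{vol}_p$; $\operatorname{vol}_0$ is the counting measure). Let $K^\circ=\{x\in\mathbb{R}^d : x^\top y\le 1\text{ for all }y\in K\}$ be the polar body of $K$. For $\eta\in\mathbb{R}^d\setminus K^\circ$ let $\sigma=\sigma_\eta=\{x\in\mathbb{R}^d:\eta^\top x=1\}$ and $$\zeta_d(\sigma)=\frac{\operatorname{vol}_{d-1}(\sigma\cap K)}{\|\eta\|\operatorname{vol}_d K},\qquad \iota_d^{(k)}(\sigma)=\int_K|\eta^\top x-1|^k\,dx .$$ Then all the integrals and expectations involved converge absolutely, and $$v_d^{(k)}(K)=\frac{(d-1)!}{d^k}\int_{\mathbb{R}^d\setminus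 K^\circ} v_{d-1}^{(k+1)}(\sigma\cap K)\,\zeta_d(\sigma)^{d+k+1}\,\iota_d^{(k)}(\sigma)\,d\eta .$$ Here the integrand is understood to be $0$ for those $\eta$ with $\operatorname{vol}_{d-1}(\sigma\cap K)=0$. -/

import Mathlib

open MeasureTheory

noncomputable section

/-- The uniform probability distribution on a `p`-dimensional set `M`: the normalised restriction
to `M` of the `p`-dimensional volume `μHE[p]` (the Hausdorff measure scaled so that it is Lebesgue
measure on `p`-dimensional Euclidean spaces). -/
def unifMeasure {d : ℕ} (p : ℕ) (M : Set (EuclideanSpace ℝ (Fin d))) :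
    Measure (EuclideanSpace ℝ (Fin d)) :=
  ProbabilityTheory.cond μHE[p] M

/-- The law of `n + 1` independent uniform points `X₀, …, Xₙ` of the `p`-dimensional set `M`. -/
def sampleLaw {d : ℕ} (p n : ℕ) (M : Set (EuclideanSpace ℝ (Fin d))) :
    Measure (Fin (n + 1) → EuclideanSpace ℝ (Fin d)) :=
  Measure.pi fun _ => unifMeasure p M

/-- The `p`-dimensional volume `Δₙ` of the convex hull of the points `X₀, …, Xₙ`. -/
def hullVolume {d : ℕ} (p n : ℕ) (X : Fin (n + 1) → EuclideanSpace ℝ (Fin d)) : ℝ :=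
  μHE[p].real (convexHull ℝ (Set.range X))

/-- The metric moment `v_n^{(k)}(M) = 𝔼 Δₙ ^ k / (vol_p M) ^ k` of a `p`-dimensional set `M`. -/
def metricMoment {d : ℕ} (p n : ℕ) (k : ℝ) (M : Set (EuclideanSpace ℝ (Fin d))) : ℝ :=
  (∫ X, hullVolume p n X ^ k ∂(sampleLaw p n M)) / μHE[p].real M ^ k

/-- The volumetric moment `v_p^{(k)}(M)` of a `p`-dimensional set `M`. -/
def volumetricMoment {d : ℕ} (p : ℕ) (k : ℝ) (M : Set (EuclideanSpace ℝ (Fin d))) : ℝ :=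
  metricMoment p p k M

/-- The polar body `K° = {x | xᵀ y ≤ 1 for all y ∈ K}`. -/
def polarBody {d : ℕ} (K : Set (EuclideanSpace ℝ (Fin d))) : Set (EuclideanSpace ℝ (Fin d)) :=
  {x | ∀ y ∈ K, inner ℝ x y ≤ 1}

/-- The hyperplane `σ = {x | ηᵀ x = 1}`. -/
def cartesianPlane {d : ℕ} (η : EuclideanSpace ℝ (Fin d)) : Set (EuclideanSpace ℝ (Fin d)) :=
  {x | inner ℝ η x = 1}

/-- `ζ_d(σ) = vol_{d-1}(σ ∩ K) / (‖η‖ vol_d K)`. -/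
def zeta {d : ℕ} (K : Set (EuclideanSpace ℝ (Fin d))) (η : EuclideanSpace ℝ (Fin d)) : ℝ :=
  μHE[d - 1].real (cartesianPlane η ∩ K) / (‖η‖ * volume.real K)

/-- `ι_d^{(k)}(σ) = ∫_K |ηᵀ x - 1| ^ k dx`. -/
def iota {d : ℕ} (k : ℝ) (K : Set (EuclideanSpace ℝ (Fin d))) (η : EuclideanSpace ℝ (Fin d)) : ℝ :=
  ∫ x in K, |inner ℝ η x - 1| ^ k

end

open scoped ENNReal

/-! In coordinates a simplex has volume `|affDet| / d!`, so up to normalisation the left side is the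
integral of `|affDet X| ^ k` over `K ^ (d + 1)`. Set one vertex `x` aside. The other `d` points
almost surely span a hyperplane `ηᵀ x = 1` with `η 0 ≠ 0`, a graph over the last `d - 1`
coordinates.

Two determinant identities carry the proof. Over fixed base points `y i`, the heights of the `d`
points depend linearly on the coefficients `w = (1 / η₀, -η' / η₀)` of the graph, through the matrix
with rows `(1, y i)`. So `dX = |affDet y| dw dy`, and `dw = |η₀| ^ (-(d + 1)) dη`; this is
`lintegral_graphPoint_affDet`. Moreover `|affDet X| = |ηᵀ x - 1| / |η₀| * |affDet y|` (base times
height, `abs_affDet_cons_graph`). Together they turn the integral into one over `η` of `|η₀| ^ (-(d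
+ 1 + k))`, the integral of `|affDet y| ^ (k + 1)` over the section, and `iota`
(`lintegral_pi_abs_affDet_rpow`).

The graph scales `(d - 1)`-volume by `‖η‖ / |η₀|`, and this factor makes the integrand coordinate
free (`section_integrand_eq`). Hyperplanes with `η` interior to the polar body miss `K`, and the
boundary of that body is null, so only its complement contributes. Computing with `ℝ≥0∞`-valued
integrals gives convergence of the outer integral for free once `|affDet| ^ k` is integrable on
bounded sets, which for `-1 < k < 0` follows by induction over minors. -/

/-! ### Volumes of simplices as determinants -/

/-- Fixing the first coordinate at `t` leaves a corner simplex of size `r - t` in one dimension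
less; integrate over `t`. -/
theorem volume_corner_simplex (p : ℕ) {r : ℝ} (hr : 0 ≤ r) :
    volume {x : Fin p → ℝ | (∀ i, 0 ≤ x i) ∧ ∑ i, x i ≤ r} =
      ENNReal.ofReal (r ^ p / p.factorial) := by
  induction p generalizing r with
  | zero => simp [hr, Measure.volume_pi_eq_dirac 0]
  | succ p ih =>
    have hmeas : MeasurableSet {x : Fin (p + 1) → ℝ | (∀ i, 0 ≤ x i) ∧ ∑ i, x i ≤ r} := by
      measurability
    rw [← ((volume_preserving_piFinSuccAbove (fun _ : Fin (p + 1) => ℝ) 0).symm).measure_preimage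
      hmeas.nullMeasurableSet, Measure.volume_eq_prod,
      Measure.prod_apply ((MeasurableEquiv.measurable _) hmeas)]
    have key : ∀ t : ℝ, volume (Prod.mk t ⁻¹' ((MeasurableEquiv.piFinSuccAbove
        (fun _ : Fin (p + 1) => ℝ) 0).symm ⁻¹' {x | (∀ i, 0 ≤ x i) ∧ ∑ i, x i ≤ r})) =
        (Set.Icc 0 r).indicator (fun t => ENNReal.ofReal ((r - t) ^ p / p.factorial)) t := by
      intro t
      by_cases ht : t ∈ Set.Icc 0 r
      · rw [Set.indicator_of_mem ht, ← ih (sub_nonneg.2 ht.2)]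
        congr 1
        ext x
        simp [Fin.forall_fin_succ, Fin.sum_univ_succ, ht.1, le_sub_iff_add_le, add_comm]
      · rw [Set.indicator_of_notMem ht]
        convert measure_empty (μ := volume) using 2
        ext x
        simp only [Set.mem_preimage, Set.mem_ofPred_eq, Set.mem_empty_iff_false, iff_false, not_and]
        intro h0 h1
        refine ht ⟨by simpa using h0 0, ?_⟩
        rw [Fin.sum_univ_succ] at h1
        have h2 := Finset.sum_nonneg fun (i : Fin p) (_ : i ∈ Finset.univ) => h0 i.succ
        simp at h1 h2
        linarith
    simp_rw [key]
    rw [lintegral_indicator measurableSet_Icc, ← ofReal_integral_eq_lintegral_ofReal]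
    · congr 1
      rw [integral_Icc_eq_integral_Ioc, ← intervalIntegral.integral_of_le hr,
        intervalIntegral.integral_comp_sub_left (fun t => t ^ p / (p.factorial : ℝ)),
        intervalIntegral.integral_div, integral_pow, Nat.factorial_succ]
      have : (p.factorial : ℝ) ≠ 0 := by positivity
      push_cast
      field_simp
      simp
    · exact (Continuous.integrableOn_Icc (by fun_prop))
    · filter_upwards [ae_restrict_mem measurableSet_Icc] with t ht
      exact div_nonneg (pow_nonneg (sub_nonneg.2 ht.2) _) (by positivity)

/-- The linear map sending the standard basis to the edges `X (i + 1) - X 0` of a simplex. -/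
noncomputable def edgeMap {p d : ℕ} (X : Fin (p + 1) → EuclideanSpace ℝ (Fin d)) :
    EuclideanSpace ℝ (Fin p) →ₗ[ℝ] EuclideanSpace ℝ (Fin d) :=
  ∑ i, (EuclideanSpace.proj i : EuclideanSpace ℝ (Fin p) →L[ℝ] ℝ).toLinearMap.smulRight
    (X i.succ - X 0)

theorem edgeMap_apply {p d : ℕ} (X : Fin (p + 1) → EuclideanSpace ℝ (Fin d))
    (t : EuclideanSpace ℝ (Fin p)) : edgeMap X t = ∑ i, t i • (X i.succ - X 0) := by
  simp [edgeMap]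

/-- Barycentric coordinates with the weight of `X 0` eliminated. No affine independence is needed.
-/
theorem convexHull_range_eq_vadd_edgeMap {p d : ℕ} (X : Fin (p + 1) → EuclideanSpace ℝ (Fin d)) :
    convexHull ℝ (Set.range X) = (fun v => X 0 +ᵥ v) '' (edgeMap X ''
      (WithLp.ofLp ⁻¹' {x : Fin p → ℝ | (∀ i, 0 ≤ x i) ∧ ∑ i, x i ≤ 1})) := by
  have h1 : convexHull ℝ (Set.range X) =
      (∑ i, (LinearMap.proj (R := ℝ) i).smulRight (X i) : (Fin (p + 1) → ℝ) →ₗ[ℝ] _) ''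
        stdSimplex ℝ (Fin (p + 1)) := by
    rw [← convexHull_basis_eq_stdSimplex, LinearMap.image_convexHull, ← Set.range_comp]
    apply congr_arg
    congr 1
    ext i : 1
    simp
  rw [h1, Set.image_image]
  ext v
  simp only [Set.mem_image, LinearMap.sum_apply, LinearMap.smulRight_apply, LinearMap.proj_apply,
    edgeMap_apply, vadd_eq_add]
  have h2 : ∀ w : Fin (p + 1) → ℝ, ∑ i, w i = 1 →
      ∑ i, w i • X i = X 0 + ∑ i : Fin p, w i.succ • (X i.succ - X 0) := by
    intro w hw
    rw [Fin.sum_univ_succ] at hw ⊢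
    rw [eq_sub_of_add_eq hw]
    simp only [smul_sub, Finset.sum_sub_distrib, ← Finset.sum_smul, sub_smul, one_smul]
    abel
  constructor
  · rintro ⟨w, ⟨hw0, hw1⟩, rfl⟩
    refine ⟨WithLp.toLp 2 fun i => w i.succ, ⟨fun i => hw0 _, ?_⟩, (h2 w hw1).symm⟩
    rw [Fin.sum_univ_succ] at hw1
    have := hw0 0
    simp only
    linarith
  · rintro ⟨t, ⟨ht0, ht1⟩, rfl⟩
    refine ⟨Fin.cons (1 - ∑ i, t i) (fun i => t i), ⟨?_, by simp [Fin.sum_univ_succ]⟩, ?_⟩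
    · exact Fin.cases (by simpa using ht1) (by simpa using ht0)
    · rw [h2 _ (by simp [Fin.sum_univ_succ])]
      simp

theorem hullVolume_eq_normDet {p d : ℕ} (X : Fin (p + 1) → EuclideanSpace ℝ (Fin d)) :
    hullVolume p p X = (edgeMap X).normDet / p.factorial := by
  have h := (edgeMap X).euclideanHausdorffMeasure_image_eq_normDet_mul_volume
    (WithLp.ofLp ⁻¹' {x : Fin p → ℝ | (∀ i, 0 ≤ x i) ∧ ∑ i, x i ≤ 1})
  rw [finrank_euclideanSpace_fin, show volume (WithLp.ofLp ⁻¹' _) = _ from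
    (EuclideanSpace.volume_preserving_symm_measurableEquiv_toLp (Fin p)).measure_preimage_equiv _,
    volume_corner_simplex p zero_le_one] at h
  rw [hullVolume, convexHull_range_eq_vadd_edgeMap, measureReal_def,
    (Isometry.euclideanHausdorffMeasure_image (f := fun v => X 0 +ᵥ v) (isometry_vadd _ _)), h,
    ENNReal.toReal_mul, ENNReal.toReal_ofReal (LinearMap.normDet_nonneg _),
    ENNReal.toReal_ofReal (by positivity), one_pow, mul_one_div]

/-- The determinant of the matrix with rows `(1, y i)`. -/
noncomputable def affDet {p : ℕ} (y : Fin (p + 1) → Fin p → ℝ) : ℝ :=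
  (Matrix.of fun i => (Fin.cons 1 (y i) : Fin (p + 1) → ℝ)).det

/-- Subtract the first row from the others and expand along the first column. -/
theorem affDet_eq_det_sub {p : ℕ} (y : Fin (p + 1) → Fin p → ℝ) :
    affDet y = (Matrix.of fun i j => y i.succ j - y 0 j).det := by
  have h : affDet y = (Matrix.of (Fin.cons (Fin.cons 1 (y 0) : Fin (p + 1) → ℝ)
      fun i => Fin.cons 0 (y i.succ - y 0))).det := by
    refine Matrix.det_eq_of_forall_row_eq_smul_add_const (Fin.cons 0 fun _ => 1) 0 rfl ?_
    intro i j
    refine Fin.cases ?_ (fun i => ?_) i <;> refine Fin.cases ?_ (fun j => ?_) j <;> simp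
  rw [h, Matrix.det_succ_column_zero, Fin.sum_univ_succ]
  simp [Matrix.submatrix]

theorem normDet_edgeMap_eq_abs_affDet {p : ℕ} (X : Fin (p + 1) → EuclideanSpace ℝ (Fin p)) :
    (edgeMap X).normDet = |affDet fun i => (X i).ofLp| := by
  rw [LinearMap.normDet_eq_norm_det_toMatrix _ (EuclideanSpace.basisFun (Fin p) ℝ)
    (EuclideanSpace.basisFun (Fin p) ℝ), affDet_eq_det_sub, ← Matrix.det_transpose,
    Real.norm_eq_abs]
  congr 2
  ext i j
  simp [LinearMap.toMatrix_apply, edgeMap_apply]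

theorem hullVolume_eq_abs_affDet {p : ℕ} (X : Fin (p + 1) → EuclideanSpace ℝ (Fin p)) :
    hullVolume p p X = |affDet fun i => (X i).ofLp| / p.factorial := by
  rw [hullVolume_eq_normDet, normDet_edgeMap_eq_abs_affDet]

/-! ### Local integrability of negative powers of determinants -/

theorem lintegral_enorm_rpow_Icc_lt_top {k : ℝ} (hk : -1 < k) :
    ∫⁻ s in Set.Icc (-1 : ℝ) 1, ‖s‖ₑ ^ k < ∞ := by
  have h0 : ∫⁻ s in Set.Ioc (0 : ℝ) 1, ‖s‖ₑ ^ k < ∞ := by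
    have h := (intervalIntegral.intervalIntegrable_rpow' (a := 0) (b := 1) hk).1.hasFiniteIntegral
    refine lt_of_le_of_lt (lintegral_mono_ae ?_) h
    filter_upwards [ae_restrict_mem measurableSet_Ioc] with s hs
    rw [Real.enorm_eq_ofReal hs.1.le, Real.enorm_eq_ofReal (Real.rpow_nonneg hs.1.le _),
      ENNReal.ofReal_rpow_of_pos hs.1]
  have h1 : ∫⁻ s in Set.Ico (-1 : ℝ) 0, ‖s‖ₑ ^ k < ∞ := by
    have h := (Measure.measurePreserving_neg (volume : Measure ℝ)).setLIntegral_comp_emb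
      (MeasurableEquiv.neg ℝ).measurableEmbedding (fun s => ‖s‖ₑ ^ k) (Set.Ico (-1 : ℝ) 0)
    simp only [enorm_neg, Set.image_neg_eq_neg, Set.neg_Ico, neg_zero, neg_neg] at h
    rwa [h]
  have hsub : Set.Icc (-1 : ℝ) 1 ⊆ (Set.Ico (-1) 0 ∪ Set.Ioc 0 1) ∪ {0} := by
    intro x hx
    rcases lt_trichotomy x 0 with h | h | h
    · exact Or.inl (Or.inl ⟨hx.1, h⟩)
    · exact Or.inr h
    · exact Or.inl (Or.inr ⟨h, hx.2⟩)
  calc _ ≤ _ := lintegral_mono_set hsub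
    _ ≤ _ := lintegral_union_le _ _ _
    _ ≤ (_ + _) + 0 := add_le_add (lintegral_union_le _ _ _) (by simp)
    _ < ∞ := by simp [h0, h1]

/-- Factoring out `c` leaves a translate of `‖s‖ₑ ^ k`, whose integral over the ball is bounded
independently of the shift. The uniformity in `c` and `w` is what the induction on determinants
needs. -/
theorem exists_lintegral_enorm_affine_rpow_le {k : ℝ} (hk : -1 < k) (hk0 : k < 0) (R : ℝ) :
    ∃ D : ℝ≥0∞, D ≠ ∞ ∧ ∀ c w : ℝ,
      ∫⁻ t in Metric.closedBall (0 : ℝ) R, ‖t * c + w‖ₑ ^ k ≤ D * ‖c‖ₑ ^ k := by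
  -- The summand `1` makes the constant visibly nonzero, so that for `c = 0` the right side is `∞`.
  refine ⟨(∫⁻ s in Set.Icc (-1 : ℝ) 1, ‖s‖ₑ ^ k) + volume (Metric.closedBall (0 : ℝ) R) + 1,
    ?_, fun c w => ?_⟩
  · simp [(lintegral_enorm_rpow_Icc_lt_top hk).ne, Real.volume_closedBall,
      ENNReal.mul_eq_top]
  rcases eq_or_ne c 0 with rfl | hc
  · simp [ENNReal.zero_rpow_of_neg hk0]
  have hc' : ∀ t, ‖t * c + w‖ₑ ^ k = ‖t + w / c‖ₑ ^ k * ‖c‖ₑ ^ k := by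
    intro t
    rw [← ENNReal.mul_rpow_of_ne_top (by simp) (by simp), ← enorm_mul, add_mul,
      div_mul_cancel₀ _ hc]
  simp_rw [hc']
  rw [lintegral_mul_const _ (by fun_prop)]
  gcongr
  refine le_trans ?_ le_self_add
  -- Outside `[-1, 1]` a negative power is at most `1`.
  have hle : ∀ t : ℝ, ‖t + w / c‖ₑ ^ k ≤
      (Set.Icc (-1 : ℝ) 1).indicator (fun s => ‖s‖ₑ ^ k) (t + w / c) + 1 := by
    intro t
    by_cases h : t + w / c ∈ Set.Icc (-1 : ℝ) 1
    · rw [Set.indicator_of_mem h]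
      exact le_self_add
    · refine le_trans ?_ le_add_self
      have h1 : 1 < |t + w / c| := not_le.1 fun h' => h (abs_le.1 h')
      refine ENNReal.rpow_le_one_of_one_le_of_neg ?_ hk0
      rw [Real.enorm_eq_ofReal_abs]
      simpa using h1.le
  calc _ ≤ ∫⁻ t in Metric.closedBall (0 : ℝ) R,
        ((Set.Icc (-1 : ℝ) 1).indicator (fun s => ‖s‖ₑ ^ k) (t + w / c) + 1) :=
        lintegral_mono fun t => hle t
    _ = (∫⁻ t in Metric.closedBall (0 : ℝ) R,
        (Set.Icc (-1 : ℝ) 1).indicator (fun s => ‖s‖ₑ ^ k) (t + w / c)) + _ :=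
        lintegral_add_right _ measurable_const
    _ ≤ (∫⁻ t, (Set.Icc (-1 : ℝ) 1).indicator (fun s => ‖s‖ₑ ^ k) (t + w / c)) + _ := by
        gcongr
        exact Measure.restrict_le_self
    _ = _ := by
        rw [lintegral_add_right_eq_self (fun s => (Set.Icc (-1 : ℝ) 1).indicator _ s),
          lintegral_indicator measurableSet_Icc]
        simp

theorem piFinSuccAbove_symm_preimage_closedBall_subset {E : Type*} [NormedAddCommGroup E]
    [MeasurableSpace E] {m : ℕ} (j : Fin (m + 1)) (R : ℝ) :
    (MeasurableEquiv.piFinSuccAbove (fun _ : Fin (m + 1) => E) j).symm ⁻¹' Metric.closedBall 0 R ⊆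
      Metric.closedBall 0 R ×ˢ Metric.closedBall 0 R := by
  rintro ⟨t, r⟩ h
  simp only [Set.mem_preimage, mem_closedBall_zero_iff, Set.mem_prod] at h ⊢
  have hR := (norm_nonneg _).trans h
  rw [pi_norm_le_iff_of_nonneg hR] at h
  refine ⟨by simpa using h j, (pi_norm_le_iff_of_nonneg hR).2 fun i => ?_⟩
  simpa using h (j.succAbove i)

/-- Only the integration in the coordinate `j` is used; the other coordinates contribute the volume
of a ball. -/
theorem exists_lintegral_enorm_linear_rpow_le {k : ℝ} (hk : -1 < k) (hk0 : k < 0) (m : ℕ) (R : ℝ) :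
    ∃ D : ℝ≥0∞, D ≠ ∞ ∧ ∀ (c : Fin (m + 1) → ℝ) (w : ℝ) (j : Fin (m + 1)),
      ∫⁻ r in Metric.closedBall (0 : Fin (m + 1) → ℝ) R, ‖∑ i, r i * c i + w‖ₑ ^ k ≤
        D * ‖c j‖ₑ ^ k := by
  obtain ⟨D, hD, h⟩ := exists_lintegral_enorm_affine_rpow_le hk hk0 R
  refine ⟨volume (Metric.closedBall (0 : Fin m → ℝ) R) * D,
    ENNReal.mul_ne_top measure_closedBall_lt_top.ne hD, fun c w j => ?_⟩
  have hpre := ((volume_preserving_piFinSuccAbove (fun _ : Fin (m + 1) => ℝ) j).symm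
    ).setLIntegral_comp_preimage_emb (MeasurableEquiv.measurableEmbedding _)
    (fun r => ‖∑ i, r i * c i + w‖ₑ ^ k) (Metric.closedBall (0 : Fin (m + 1) → ℝ) R)
  rw [← hpre]
  refine (lintegral_mono_set
      (piFinSuccAbove_symm_preimage_closedBall_subset _ _)).trans ?_
  rw [Measure.volume_eq_prod, ← Measure.prod_restrict, lintegral_prod_symm _ (by fun_prop)]
  have hle : ∀ r : Fin m → ℝ, ∫⁻ t in Metric.closedBall (0 : ℝ) R,
      ‖∑ i, (MeasurableEquiv.piFinSuccAbove (fun _ : Fin (m + 1) => ℝ) j).symm (t, r) i * c i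
        + w‖ₑ ^ k ≤ D * ‖c j‖ₑ ^ k := by
    intro r
    have := h (c j) (∑ i, r i * c (j.succAbove i) + w)
    simpa [Fin.sum_univ_succAbove _ j, add_assoc] using this
  refine (lintegral_mono hle).trans ?_
  rw [setLIntegral_const]
  ring_nf
  rfl

/-- Separates the first column of a matrix. -/
def splitCol (m n : ℕ) : (Fin m → Fin (n + 1) → ℝ) ≃ᵐ (Fin m → ℝ) × (Fin m → Fin n → ℝ) :=
  (MeasurableEquiv.piCongrRight fun _ => MeasurableEquiv.piFinSuccAbove (fun _ => ℝ) 0).trans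
    (MeasurableEquiv.arrowProdEquivProdArrow ℝ (Fin n → ℝ) (Fin m))

theorem splitCol_symm_apply (m n : ℕ) (z : Fin m → ℝ) (y : Fin m → Fin n → ℝ) :
    (splitCol m n).symm (z, y) = fun i => Fin.cons (z i) (y i) := by
  rw [MeasurableEquiv.symm_apply_eq]
  rfl

theorem volume_preserving_splitCol (m n : ℕ) : MeasurePreserving (splitCol m n) :=
  (volume_preserving_pi fun _ => volume_preserving_piFinSuccAbove _ 0).trans
    (volume_measurePreserving_arrowProdEquivProdArrow ℝ (Fin n → ℝ) (Fin m))

theorem measurable_matrix_det {α : Type*} [MeasurableSpace α] {p : ℕ}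
    {f : α → Fin p → Fin p → ℝ} (hf : Measurable f) : Measurable fun x => (Matrix.of (f x)).det := by
  simp only [Matrix.det_apply, Matrix.of_apply]
  fun_prop

/-- The determinant is linear in its first row with the cofactors as coefficients. Integrating out
that row leaves a power of a single minor, to which the induction hypothesis applies; the first
column of the remaining rows is then free. -/
theorem lintegral_enorm_det_rpow_lt_top {k : ℝ} (hk : -1 < k) (hk0 : k < 0) (m : ℕ) (R : ℝ) :
    ∫⁻ A in Metric.closedBall (0 : Fin m → Fin m → ℝ) R, ‖(Matrix.of A).det‖ₑ ^ k < ∞ := by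
  induction m with
  | zero => simp
  | succ m ih =>
    obtain ⟨D, hD, h⟩ := exists_lintegral_enorm_linear_rpow_le hk hk0 m R
    rw [← ((volume_preserving_piFinSuccAbove (fun _ : Fin (m + 1) => Fin (m + 1) → ℝ) 0).symm
      ).setLIntegral_comp_preimage_emb (MeasurableEquiv.measurableEmbedding _)]
    refine (lintegral_mono_set
      (piFinSuccAbove_symm_preimage_closedBall_subset _ _)).trans_lt ?_
    rw [Measure.volume_eq_prod, ← Measure.prod_restrict, lintegral_prod_symm]
    · have hle : ∀ B : Fin m → Fin (m + 1) → ℝ, ∫⁻ r in Metric.closedBall (0 : Fin (m + 1) → ℝ) R,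
          ‖(Matrix.of ((MeasurableEquiv.piFinSuccAbove
            (fun _ : Fin (m + 1) => Fin (m + 1) → ℝ) 0).symm (r, B))).det‖ₑ ^ k ≤
          D * ‖(Matrix.of fun i j => B i (Fin.succ j)).det‖ₑ ^ k := by
        intro B
        have := h (fun j => (-1) ^ (j : ℕ) * (Matrix.of fun i l => B i (j.succAbove l)).det) 0 0
        simp only [add_zero, Fin.val_zero, pow_zero, one_mul] at this
        refine le_trans (le_of_eq ?_) this
        congr 1 with r
        rw [Matrix.det_succ_row_zero]
        congr 3 with j
        simp [mul_comm, mul_assoc, Matrix.submatrix]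
      refine (lintegral_mono hle).trans_lt ?_
      rw [lintegral_const_mul']
      swap
      · exact hD
      refine ENNReal.mul_lt_top hD.lt_top ?_
      rw [← (volume_preserving_splitCol m m).symm.setLIntegral_comp_preimage_emb
        (MeasurableEquiv.measurableEmbedding _)]
      have hsub : (splitCol m m).symm ⁻¹' (Metric.closedBall 0 R) ⊆
          Metric.closedBall 0 R ×ˢ Metric.closedBall 0 R := by
        rintro ⟨z, y⟩ h
        simp only [Set.mem_preimage, mem_closedBall_zero_iff, Set.mem_prod,
          splitCol_symm_apply] at h ⊢
        have hR := (norm_nonneg _).trans h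
        simp only [pi_norm_le_iff_of_nonneg hR] at h ⊢
        exact ⟨fun i => by simpa using h i 0, fun i j => by simpa using h i j.succ⟩
      refine (lintegral_mono_set hsub).trans_lt ?_
      simp only [Measure.volume_eq_prod]
      rw [← Measure.prod_restrict, lintegral_prod]
      · simp only [splitCol_symm_apply, Fin.cons_succ]
        rw [lintegral_const]
        exact ENNReal.mul_lt_top ih (by simp [measure_closedBall_lt_top])
      · refine ((measurable_matrix_det ?_).enorm.pow_const _).aemeasurable
        have := (splitCol m m).symm.measurable
        fun_prop
    · exact ((measurable_matrix_det (MeasurableEquiv.measurable _)).enorm.pow_const _).aemeasurable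

theorem measurable_affDet {p : ℕ} : Measurable (affDet (p := p)) := by
  unfold affDet
  refine measurable_matrix_det (measurable_pi_lambda _ fun i => measurable_pi_lambda _ fun j => ?_)
  refine Fin.cases ?_ (fun j => ?_) j <;> simp only [Fin.cons_zero, Fin.cons_succ] <;> fun_prop

theorem continuous_affDet {p : ℕ} : Continuous (affDet (p := p)) := by
  unfold affDet
  refine Continuous.matrix_det (continuous_pi fun i => continuous_pi fun j => ?_)
  refine Fin.cases ?_ (fun j => ?_) j <;> simp only [Matrix.of_apply, Fin.cons_zero, Fin.cons_succ] <;>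
    fun_prop

theorem lintegral_enorm_affDet_rpow_lt_top {k : ℝ} (hk : -1 < k) (hk0 : k < 0) (p : ℕ) (R : ℝ) :
    ∫⁻ y in Metric.closedBall (0 : Fin (p + 1) → Fin p → ℝ) R, ‖affDet y‖ₑ ^ k < ∞ := by
  rw [← ((volume_preserving_piFinSuccAbove (fun _ : Fin (p + 1) => Fin p → ℝ) 0).symm
      ).setLIntegral_comp_preimage_emb (MeasurableEquiv.measurableEmbedding _)]
  refine (lintegral_mono_set
      (piFinSuccAbove_symm_preimage_closedBall_subset _ _)).trans_lt ?_
  rw [Measure.volume_eq_prod, ← Measure.prod_restrict, lintegral_prod]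
  swap
  · exact ((measurable_affDet.comp (MeasurableEquiv.measurable _)).enorm.pow_const _).aemeasurable
  have hle : ∀ y₀ ∈ Metric.closedBall (0 : Fin p → ℝ) R,
      ∫⁻ y in Metric.closedBall (0 : Fin p → Fin p → ℝ) R,
      ‖affDet ((MeasurableEquiv.piFinSuccAbove
            (fun _ : Fin (p + 1) => Fin p → ℝ) 0).symm (y₀, y))‖ₑ ^ k ≤
      -- Translating by `y₀` reduces to a determinant of differences, and these lie in the doubled
      -- ball.
      ∫⁻ A in Metric.closedBall (0 : Fin p → Fin p → ℝ) (R + R), ‖(Matrix.of A).det‖ₑ ^ k := by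
    intro y₀ hy₀
    rw [← lintegral_indicator Metric.isClosed_closedBall.measurableSet,
      ← lintegral_indicator Metric.isClosed_closedBall.measurableSet]
    refine le_of_le_of_eq ?_ (lintegral_sub_right_eq_self _ (fun _ : Fin p => y₀))
    refine lintegral_mono fun y => ?_
    refine Set.indicator_apply_le' (fun hy => ?_) (fun _ => zero_le)
    rw [Set.indicator_of_mem]
    · simp [affDet_eq_det_sub]
      rfl
    · rw [mem_closedBall_zero_iff] at *
      refine (norm_sub_le _ _).trans (add_le_add hy ?_)
      exact (pi_norm_const_le _).trans hy₀
  refine (setLIntegral_mono' Metric.isClosed_closedBall.measurableSet hle).trans_lt ?_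
  rw [setLIntegral_const]
  exact ENNReal.mul_lt_top (lintegral_enorm_det_rpow_lt_top hk hk0 _ _) measure_closedBall_lt_top

/-- A negative power is `∞` at zeros of `affDet`, yet has finite integral over every ball; `-1 / 2`
is an arbitrary exponent in `(-1, 0)`. -/
theorem ae_affDet_ne_zero (p : ℕ) : ∀ᵐ y : Fin (p + 1) → Fin p → ℝ, affDet y ≠ 0 := by
  have h : ∀ N : ℕ, ∀ᵐ y : Fin (p + 1) → Fin p → ℝ,
      y ∈ Metric.closedBall (0 : Fin (p + 1) → Fin p → ℝ) N → affDet y ≠ 0 := by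
    intro N
    rw [← ae_restrict_iff' Metric.isClosed_closedBall.measurableSet]
    have := ae_lt_top (measurable_affDet.enorm.pow_const _)
      (lintegral_enorm_affDet_rpow_lt_top (k := -1 / 2) (by norm_num) (by norm_num) p N).ne
    filter_upwards [this] with y hy h0
    rw [h0, enorm_zero, ENNReal.zero_rpow_of_neg (by norm_num)] at hy
    exact hy.ne rfl
  filter_upwards [ae_all_iff.2 h] with y hy
  obtain ⟨N, hN⟩ := exists_nat_ge ‖y‖
  exact hy N (by simpa using hN)

/-! ### Dual coordinates and the affine Blaschke–Petkantschin formula -/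

theorem lintegral_inv_sq_comp_inv (h : ℝ → ℝ≥0∞) :
    ∫⁻ t : ℝ, ENNReal.ofReal ((|t| ^ 2)⁻¹) * h t⁻¹ = ∫⁻ s, h s := by
  have himg : (fun t : ℝ => t⁻¹) '' {0}ᶜ = {0}ᶜ := by
    ext s
    refine ⟨?_, fun hs => ⟨s⁻¹, by simpa using hs, inv_inv s⟩⟩
    rintro ⟨t, ht, rfl⟩
    simpa using ht
  have h1 := lintegral_image_eq_lintegral_abs_deriv_mul (s := {(0 : ℝ)}ᶜ) (by measurability)
    (fun x hx => (hasDerivAt_inv hx).hasDerivWithinAt) inv_injective.injOn h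
  rw [himg, restrict_compl_singleton] at h1
  rw [h1]
  refine lintegral_congr fun t => ?_
  rw [abs_neg, abs_inv, abs_pow]

theorem lintegral_comp_smul_eq {m : ℕ} {r : ℝ} (hr : r ≠ 0) {h : (Fin m → ℝ) → ℝ≥0∞}
    (hh : Measurable h) :
    ∫⁻ v, h (r • v) = ENNReal.ofReal ((|r| ^ m)⁻¹) * ∫⁻ a, h a := by
  rw [← lintegral_map hh (measurable_const_smul r), Measure.map_addHaar_smul _ hr,
    lintegral_smul_measure, Module.finrank_fin_fun, abs_inv, abs_pow, smul_eq_mul]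

theorem lintegral_piFinSuccAbove_zero {E : Type*} [MeasureSpace E]
    [SigmaFinite (volume : Measure E)] {m : ℕ} {f : (Fin (m + 1) → E) → ℝ≥0∞} (hf : Measurable f) :
    ∫⁻ x, f x = ∫⁻ t, ∫⁻ v, f (Fin.cons t v) := by
  rw [← (volume_preserving_piFinSuccAbove (fun _ : Fin (m + 1) => E) 0).symm.lintegral_comp hf,
    Measure.volume_eq_prod, lintegral_prod _ (by fun_prop)]
  simp
  rfl

/-- The dual coordinates `(1 / η₀, -η' / η₀)` turn the hyperplanes `ηᵀ x = 1` into graphs. -/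
theorem lintegral_graph_coordinates {m : ℕ} {H : (Fin (m + 1) → ℝ) → ℝ≥0∞} (hH : Measurable H) :
    ∫⁻ η : Fin (m + 1) → ℝ, ENNReal.ofReal ((|η 0| ^ (m + 2))⁻¹) *
      H (Fin.cons (η 0)⁻¹ fun j => -(η 0)⁻¹ * η j.succ) = ∫⁻ w, H w := by
  have hcons : Measurable fun q : ℝ × (Fin m → ℝ) => (Fin.cons q.1 q.2 : Fin (m + 1) → ℝ) := by
    have h := (MeasurableEquiv.piFinSuccAbove (fun _ : Fin (m + 1) => ℝ) 0).symm.measurable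
    simp only [MeasurableEquiv.piFinSuccAbove_symm_apply, Fin.insertNthEquiv_zero] at h
    exact h
  have hHc : ∀ t : ℝ, Measurable fun v : Fin m → ℝ => H (Fin.cons t v) := fun t =>
    hH.comp (hcons.comp (measurable_const.prodMk measurable_id))
  rw [lintegral_piFinSuccAbove_zero hH, lintegral_piFinSuccAbove_zero,
    ← lintegral_inv_sq_comp_inv]
  · refine lintegral_congr_ae ?_
    filter_upwards [Measure.ae_ne volume 0] with t ht
    have h1 := lintegral_comp_smul_eq (neg_ne_zero.2 ht) (hHc t)
    simp only [Fin.cons_zero, Fin.cons_succ, inv_inv]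
    rw [lintegral_const_mul' _ _ ENNReal.ofReal_ne_top,
      show (fun v : Fin m → ℝ => H (Fin.cons t fun j => -t * v j)) =
        fun v => H (Fin.cons t (-t • v)) from rfl, h1, ← mul_assoc, ← mul_assoc,
      ← ENNReal.ofReal_mul (by positivity), ← ENNReal.ofReal_mul (by positivity)]
    have : |t| ≠ 0 := by simpa
    -- Here `t = 1 / η₀`: the inversion gives the exponent `2`, the scaling of the other `m`
    -- coordinates gives `m`, and both cancel against the weight.
    rw [abs_neg, abs_inv, show (|t| ^ 2)⁻¹ * (|t|⁻¹ ^ (m + 2))⁻¹ * (|t| ^ m)⁻¹ = 1 by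
        rw [inv_pow, inv_inv, pow_add]; field_simp,
      ENNReal.ofReal_one, one_mul]
  · refine Measurable.mul (by fun_prop) (hH.comp (hcons.comp (Measurable.prodMk ?_ ?_))) <;> fun_prop

/-- The point of the hyperplane `ηᵀ x = 1` with the coordinates `y` off the index `j`. -/
noncomputable def graphPoint {n : ℕ} (j : Fin (n + 1)) (η : Fin (n + 1) → ℝ) (y : Fin n → ℝ) :
    Fin (n + 1) → ℝ :=
  j.insertNth ((1 - ∑ i, η (j.succAbove i) * y i) / η j) y

theorem graphPoint_zero {n : ℕ} (η : Fin (n + 1) → ℝ) (y : Fin n → ℝ) :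
    graphPoint 0 η y = Fin.cons ((1 - ∑ i, η i.succ * y i) / η 0) y := by
  simp [graphPoint]

theorem measurable_fin_cons {m : ℕ} {α : Type*} [MeasurableSpace α] {f : α → ℝ}
    {g : α → Fin m → ℝ} (hf : Measurable f) (hg : Measurable g) :
    Measurable fun a => (Fin.cons (f a) (g a) : Fin (m + 1) → ℝ) := by
  refine measurable_pi_lambda _ fun i => ?_
  refine Fin.cases ?_ (fun i => ?_) i <;> simp only [Fin.cons_zero, Fin.cons_succ] <;> fun_prop

/-- The affine Blaschke–Petkantschin formula, in graph coordinates. -/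
theorem lintegral_graphPoint_affDet {n : ℕ} {F : (Fin (n + 1) → Fin (n + 1) → ℝ) → ℝ≥0∞}
    (hF : Measurable F) :
    ∫⁻ η : Fin (n + 1) → ℝ, ENNReal.ofReal ((|η 0| ^ (n + 2))⁻¹) *
      ∫⁻ y : Fin (n + 1) → Fin n → ℝ, ENNReal.ofReal |affDet y| *
        F (fun i => graphPoint 0 η (y i)) = ∫⁻ X, F X := by
  set M : (Fin (n + 1) → Fin n → ℝ) → Matrix (Fin (n + 1)) (Fin (n + 1)) ℝ :=
    fun y => Matrix.of fun i => Fin.cons 1 (y i) with hM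
  have hMw : ∀ y w i, (M y).mulVec w i = w 0 + ∑ j, w j.succ * y i j := by
    intro y w i
    simp [hM, Matrix.mulVec, dotProduct, Fin.sum_univ_succ, mul_comm]
  have hjoint : Measurable fun q : (Fin (n + 1) → ℝ) × (Fin (n + 1) → Fin n → ℝ) =>
      ENNReal.ofReal |affDet q.2| * F (fun i => Fin.cons ((M q.2).mulVec q.1 i) (q.2 i)) := by
    refine Measurable.mul ?_ (hF.comp (measurable_pi_lambda _ fun i => measurable_fin_cons ?_ ?_))
    · exact (measurable_affDet.comp measurable_snd).abs.ennreal_ofReal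
    · simp only [hMw]
      fun_prop
    · fun_prop
  have hstep := lintegral_graph_coordinates
    (H := fun w => ∫⁻ y : Fin (n + 1) → Fin n → ℝ, ENNReal.ofReal |affDet y| *
        F (fun i => Fin.cons ((M y).mulVec w i) (y i))) hjoint.lintegral_prod_right'
  calc _ = _ := by
        refine lintegral_congr fun η => ?_
        congr 1
        refine lintegral_congr fun y => ?_
        congr 2
        ext i : 1
        rw [graphPoint_zero, hMw]
        congr 1
        simp only [Fin.cons_zero, Fin.cons_succ, neg_mul, Finset.sum_neg_distrib, mul_assoc,
          ← Finset.mul_sum]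
        ring
    _ = _ := hstep
    _ = ∫⁻ y : Fin (n + 1) → Fin n → ℝ, ∫⁻ w : Fin (n + 1) → ℝ, ENNReal.ofReal |affDet y| *
        F (fun i => Fin.cons ((M y).mulVec w i) (y i)) :=
        lintegral_lintegral_swap hjoint.aemeasurable
    _ = ∫⁻ y : Fin (n + 1) → Fin n → ℝ, ∫⁻ z : Fin (n + 1) → ℝ,
        F (fun i => Fin.cons (z i) (y i)) := by
        refine lintegral_congr_ae ?_
        filter_upwards [ae_affDet_ne_zero n] with y hy
        have hG : Measurable fun z : Fin (n + 1) → ℝ => F (fun i => Fin.cons (z i) (y i)) :=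
          hF.comp (measurable_pi_lambda _ fun i =>
            measurable_fin_cons (by fun_prop) measurable_const)
        have hmap := Real.map_matrix_volume_pi_eq_smul_volume_pi (M := M y) hy
        have hlin : Measurable (Matrix.toLin' (M y)) :=
          (LinearMap.continuous_of_finiteDimensional _).measurable
        have h1 := lintegral_map (μ := volume) hG hlin
        rw [hmap, lintegral_smul_measure, smul_eq_mul] at h1
        rw [lintegral_const_mul' _ _ ENNReal.ofReal_ne_top]
        simp only [Matrix.toLin'_apply] at h1
        -- The Jacobian of `w ↦ M y *ᵥ w` cancels the weight `|affDet y|`.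
        rw [← h1, ← mul_assoc, ← ENNReal.ofReal_mul (abs_nonneg _), ← abs_mul,
          show affDet y * (M y).det⁻¹ = 1 from mul_inv_cancel₀ hy, abs_one, ENNReal.ofReal_one,
          one_mul]
    _ = _ := by
        rw [← (volume_preserving_splitCol (n + 1) n).symm.lintegral_comp hF,
          Measure.volume_eq_prod, lintegral_prod_symm']
        · simp only [splitCol_symm_apply]
        · fun_prop

/-! ### Base times height -/

/-- Subtracting from the height column the affine function that defines the graph annihilates it in
every row except that of `x`; expand along this column. -/
theorem abs_affDet_cons_graph {n : ℕ} (w x : Fin (n + 1) → ℝ) (y : Fin (n + 1) → Fin n → ℝ) :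
    |affDet (Fin.cons x fun i => Fin.cons (w 0 + ∑ j : Fin n, w j.succ * y i j) (y i))| =
      |x 0 - (w 0 + ∑ j : Fin n, w j.succ * x j.succ)| * |affDet y| := by
  set M : Matrix (Fin (n + 2)) (Fin (n + 2)) ℝ := Matrix.of fun i => Fin.cons 1
    ((Fin.cons x fun i => Fin.cons (w 0 + ∑ j : Fin n, w j.succ * y i j) (y i) :
      Fin (n + 2) → Fin (n + 1) → ℝ) i) with hM
  set c : Fin (n + 2) → ℝ := Fin.cons (-w 0) (Fin.cons 1 fun j => -w j.succ) with hc
  have h := Matrix.det_updateCol_sum M 1 c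
  have hc0 : c 0 = -w 0 := rfl
  have hc1 : c (Fin.succ 0) = 1 := rfl
  have hc2 : ∀ j : Fin n, c j.succ.succ = -w j.succ := fun _ => rfl
  have hrow0 : ∑ k, c k • M 0 k = x 0 - (w 0 + ∑ j : Fin n, w j.succ * x j.succ) := by
    simp only [Fin.sum_univ_succ, hc0, hc1, hc2, hM]
    simp
    ring
  have hrow : ∀ i : Fin (n + 1), ∑ k, c k • M i.succ k = 0 := by
    intro i
    simp only [Fin.sum_univ_succ, hc0, hc1, hc2, hM]
    simp
  have hone : c 1 = 1 := rfl
  rw [hone, one_smul, Matrix.det_succ_column _ 1, Fin.sum_univ_succ] at h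
  simp only [Matrix.updateCol_self, hrow0, hrow, mul_zero, zero_mul, Finset.sum_const_zero,
    add_zero, Matrix.submatrix_updateCol_succAbove] at h
  rw [affDet, ← hM, ← h]
  have hsub : M.submatrix (Fin.succAbove 0) (Fin.succAbove 1) =
      Matrix.of fun i => (Fin.cons 1 (y i) : Fin (n + 1) → ℝ) := by
    ext i j
    refine Fin.cases ?_ (fun j => ?_) j <;> simp [hM]
  rw [hsub]
  simp only [affDet, abs_mul, abs_pow, abs_neg, abs_one, one_pow, one_mul]

theorem ofReal_mul_rpow_mul {k a b : ℝ} (hk : -1 < k) :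
    ENNReal.ofReal |b| * ENNReal.ofReal (|a * b| ^ k) =
      ENNReal.ofReal (|b| ^ (k + 1)) * ENNReal.ofReal (|a| ^ k) := by
  rw [← ENNReal.ofReal_mul (abs_nonneg _), ← ENNReal.ofReal_mul (by positivity), abs_mul,
    Real.mul_rpow (abs_nonneg _) (abs_nonneg _), add_comm k,
    Real.rpow_one_add' (abs_nonneg _) (by linarith)]
  ring_nf

/-- The vertex `X 0` is integrated innermost and the Blaschke–Petkantschin formula is applied to the
others. Its Jacobian raises the power of `affDet y` to `k + 1`; the height `(ηᵀ x - 1) / η₀` adds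
`k` to the exponent `n + 2` of `|η 0|`. -/
theorem lintegral_pi_abs_affDet_rpow {n : ℕ} {k : ℝ} (hk : -1 < k) {S : Set (Fin (n + 1) → ℝ)}
    (hS : MeasurableSet S) :
    ∫⁻ X in Set.univ.pi (fun _ : Fin (n + 2) => S), ENNReal.ofReal (|affDet X| ^ k) =
      ∫⁻ η : Fin (n + 1) → ℝ, ENNReal.ofReal ((|η 0| ^ ((n : ℝ) + 2 + k))⁻¹) *
        ((∫⁻ y in {y : Fin (n + 1) → Fin n → ℝ | ∀ i, graphPoint 0 η (y i) ∈ S},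
          ENNReal.ofReal (|affDet y| ^ (k + 1))) *
        ∫⁻ x in S, ENNReal.ofReal (|∑ i, η i * x i - 1| ^ k)) := by
  have hpi : ∀ m, MeasurableSet (Set.univ.pi (fun _ : Fin m => S)) := fun m =>
    MeasurableSet.univ_pi fun _ => hS
  have hk' : Measurable fun a : ℝ => ENNReal.ofReal (|a| ^ k) := by fun_prop
  have hcons : Measurable fun q : (Fin (n + 1) → ℝ) × (Fin (n + 1) → Fin (n + 1) → ℝ) =>
      (Fin.cons q.1 q.2 : Fin (n + 2) → Fin (n + 1) → ℝ) := by
    refine measurable_pi_lambda _ fun i => ?_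
    refine Fin.cases ?_ (fun i => ?_) i <;> simp only [Fin.cons_zero, Fin.cons_succ] <;> fun_prop
  have hinner : Measurable fun X' : Fin (n + 1) → Fin (n + 1) → ℝ =>
      ∫⁻ x in S, ENNReal.ofReal (|affDet (Fin.cons x X' : Fin (n + 2) → _)| ^ k) :=
    Measurable.lintegral_prod_left' (hk'.comp (measurable_affDet.comp hcons))
  have hind : Measurable ((Set.univ.pi fun _ => S).indicator
      fun X : Fin (n + 2) → Fin (n + 1) → ℝ => ENNReal.ofReal (|affDet X| ^ k)) :=
    (hk'.comp measurable_affDet).indicator (hpi _)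
  rw [← lintegral_indicator (hpi _), lintegral_piFinSuccAbove_zero hind,
    lintegral_lintegral_swap (f := fun t v => (Set.univ.pi fun _ => S).indicator
      (fun X : Fin (n + 2) → Fin (n + 1) → ℝ => ENNReal.ofReal (|affDet X| ^ k)) (Fin.cons t v))
      (hind.comp hcons).aemeasurable]
  have hslice : ∀ X' : Fin (n + 1) → Fin (n + 1) → ℝ, ∫⁻ x, (Set.univ.pi fun _ => S).indicator
      (fun X => ENNReal.ofReal (|affDet X| ^ k)) (Fin.cons x X' : Fin (n + 2) → _) =
      (Set.univ.pi fun _ => S).indicator (fun X' => ∫⁻ x in S, ENNReal.ofReal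
        (|affDet (Fin.cons x X' : Fin (n + 2) → _)| ^ k)) X' := by
    intro X'
    by_cases hX : X' ∈ Set.univ.pi fun _ => S
    · rw [Set.indicator_of_mem hX, ← lintegral_indicator hS]
      refine lintegral_congr fun x => ?_
      have hmem : (Fin.cons x X' : Fin (n + 2) → Fin (n + 1) → ℝ) ∈
          Set.univ.pi (fun _ => S) ↔ x ∈ S := by
        rw [Set.mem_univ_pi, Fin.forall_fin_succ]
        simpa using fun _ => Set.mem_univ_pi.1 hX
      by_cases hx : x ∈ S
      · rw [Set.indicator_of_mem (hmem.2 hx), Set.indicator_of_mem hx]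
      · rw [Set.indicator_of_notMem (hmem.not.2 hx), Set.indicator_of_notMem hx]
    · rw [Set.indicator_of_notMem hX, lintegral_eq_zero_of_ae_eq_zero]
      refine Filter.Eventually.of_forall fun x => Set.indicator_of_notMem (fun h => hX ?_) _
      rw [Set.mem_univ_pi] at h ⊢
      exact fun i => h i.succ
  simp_rw [hslice]
  rw [← lintegral_graphPoint_affDet (hinner.indicator (hpi _))]
  refine lintegral_congr_ae ?_
  have h0 : ∀ᵐ η : Fin (n + 1) → ℝ, η 0 ≠ 0 := Measure.ae_eval_ne (μ := fun _ => volume) 0 0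
  filter_upwards [h0] with η hη
  have hgraph : Measurable (graphPoint 0 η) := by
    simp_rw [funext (graphPoint_zero η)]
    exact measurable_fin_cons (by fun_prop) (by fun_prop)
  have hset : MeasurableSet {y : Fin (n + 1) → Fin n → ℝ | ∀ i, graphPoint 0 η (y i) ∈ S} := by
    simp only [Set.ofPred_forall]
    exact MeasurableSet.iInter fun i => (hgraph.comp (measurable_pi_apply i)) hS
  have hpt : ∀ (y : Fin (n + 1) → Fin n → ℝ) (x : Fin (n + 1) → ℝ), ENNReal.ofReal |affDet y| *
      ENNReal.ofReal (|affDet (Fin.cons x fun i => graphPoint 0 η (y i) : Fin (n + 2) → _)| ^ k) =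
      ENNReal.ofReal (|affDet y| ^ (k + 1)) * (ENNReal.ofReal ((|η 0| ^ k)⁻¹) *
        ENNReal.ofReal (|∑ i, η i * x i - 1| ^ k)) := by
    intro y x
    have h1 : (fun i => graphPoint 0 η (y i)) = fun i => (Fin.cons ((Fin.cons (η 0)⁻¹
        (fun j => -(η 0)⁻¹ * η j.succ) : Fin (n + 1) → ℝ) 0 + ∑ j : Fin n, (Fin.cons (η 0)⁻¹
        (fun j => -(η 0)⁻¹ * η j.succ) : Fin (n + 1) → ℝ) j.succ * y i j) (y i) :
          Fin (n + 1) → ℝ) := by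
      ext i : 1
      rw [graphPoint_zero]
      congr 1
      simp only [Fin.cons_zero, Fin.cons_succ, neg_mul, Finset.sum_neg_distrib, mul_assoc,
          ← Finset.mul_sum]
      ring
    have h2 : x 0 - ((η 0)⁻¹ + ∑ j : Fin n, -(η 0)⁻¹ * η j.succ * x j.succ) =
        (η 0)⁻¹ * (∑ i, η i * x i - 1) := by
      rw [Fin.sum_univ_succ]
      simp only [neg_mul, Finset.sum_neg_distrib, mul_assoc, ← Finset.mul_sum]
      field_simp
      ring
    rw [h1, ← abs_abs (affDet (Fin.cons _ _)), abs_affDet_cons_graph, ← abs_mul, abs_abs,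
      ofReal_mul_rpow_mul hk]
    simp only [Fin.cons_zero, Fin.cons_succ, h2]
    rw [abs_mul, Real.mul_rpow (abs_nonneg _) (abs_nonneg _), ENNReal.ofReal_mul (by positivity),
      abs_inv, Real.inv_rpow (abs_nonneg _)]
  have hy : ∀ y : Fin (n + 1) → Fin n → ℝ, ENNReal.ofReal |affDet y| *
      (Set.univ.pi fun _ => S).indicator (fun X' => ∫⁻ x in S, ENNReal.ofReal
        (|affDet (Fin.cons x X' : Fin (n + 2) → _)| ^ k)) (fun i => graphPoint 0 η (y i)) =
      {y : Fin (n + 1) → Fin n → ℝ | ∀ i, graphPoint 0 η (y i) ∈ S}.indicator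
        (fun y => ENNReal.ofReal (|affDet y| ^ (k + 1))) y * (ENNReal.ofReal ((|η 0| ^ k)⁻¹) *
        ∫⁻ x in S, ENNReal.ofReal (|∑ i, η i * x i - 1| ^ k)) := by
    intro y
    by_cases h : ∀ i, graphPoint 0 η (y i) ∈ S
    · rw [Set.indicator_of_mem (by simpa using h), Set.indicator_of_mem (by exact h),
        ← lintegral_const_mul' _ _ ENNReal.ofReal_ne_top,
        ← lintegral_const_mul' _ _ ENNReal.ofReal_ne_top,
        ← lintegral_const_mul' _ _ ENNReal.ofReal_ne_top]
      exact lintegral_congr fun x => hpt y x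
    · rw [Set.indicator_of_notMem (by simpa using h), Set.indicator_of_notMem (by exact h)]
      simp
  simp_rw [hy]
  rw [lintegral_mul_const _ (Measurable.indicator (by
    have := measurable_affDet (p := n); fun_prop) hset), lintegral_indicator hset,
    show (n : ℝ) + 2 + k = ((n + 2 : ℕ) : ℝ) + k by push_cast; ring,
    Real.rpow_add (abs_pos.2 hη), Real.rpow_natCast, mul_inv, ENNReal.ofReal_mul (by positivity)]
  ring

/-! ### Volume charts of hyperplanes and moments in a chart -/

/-- An injective parametrisation of a flat by `p` coordinates that scales `p`-dimensional volume by
the constant `C`. -/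
structure IsVolumeChart {p d : ℕ} (φ : (Fin p → ℝ) → EuclideanSpace ℝ (Fin d)) (C : ℝ) : Prop where
  continuous : Continuous φ
  injective : Function.Injective φ
  pos : 0 < C
  volume_image : ∀ s, μHE[p] (φ '' s) = ENNReal.ofReal C * volume s
  hullVolume_comp : ∀ y, hullVolume p p (fun i => φ (y i)) = C * (|affDet y| / p.factorial)

theorem isVolumeChart_toLp (p : ℕ) : IsVolumeChart (WithLp.toLp 2 : (Fin p → ℝ) → _) 1 where
  continuous := PiLp.continuous_toLp 2 _
  injective := WithLp.toLp_injective 2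
  pos := one_pos
  volume_image s := by
    rw [EuclideanSpace.euclideanHausdorffMeasure_eq_volume, ENNReal.ofReal_one, one_mul,
      ← (EuclideanSpace.volume_preserving_symm_measurableEquiv_toLp (Fin p)).measure_preimage_equiv]
    congr 1
    exact (MeasurableEquiv.toLp 2 (Fin p → ℝ)).toEquiv.image_eq_preimage_symm s
  hullVolume_comp y := by rw [hullVolume_eq_abs_affDet, one_mul]

/-- The direction part of `graphPoint`. -/
noncomputable def graphLinear {n : ℕ} (j : Fin (n + 1)) (η : Fin (n + 1) → ℝ) :
    EuclideanSpace ℝ (Fin n) →ₗ[ℝ] EuclideanSpace ℝ (Fin (n + 1)) where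
  toFun y := WithLp.toLp 2 (j.insertNth (-(∑ i, η (j.succAbove i) * y i) / η j) y.ofLp)
  map_add' x y := by
    ext l
    refine Fin.succAboveCases j ?_ (fun i => ?_) l
    · simp [mul_add, Finset.sum_add_distrib]
      ring
    · simp
  map_smul' c y := by
    ext l
    refine Fin.succAboveCases j ?_ (fun i => ?_) l
    · simp [Finset.mul_sum, mul_left_comm, mul_div_assoc, neg_div, Finset.sum_div]
    · simp

theorem toLp_graphPoint {n : ℕ} (j : Fin (n + 1)) (η : Fin (n + 1) → ℝ) (y : Fin n → ℝ) :
    WithLp.toLp 2 (graphPoint j η y) =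
      WithLp.toLp 2 (graphPoint j η 0) +ᵥ graphLinear j η (WithLp.toLp 2 y) := by
  ext l
  refine Fin.succAboveCases j ?_ (fun i => ?_) l
  · simp [graphPoint, graphLinear]
    ring
  · simp [graphPoint, graphLinear]

/-- The Gram matrix is `1 + a aᵀ` with `a i = η i / η j` for `i ≠ j`, so its determinant is `1 +
‖a‖² = ‖η‖² / (η j)²`. -/
theorem normDet_graphLinear {n : ℕ} {j : Fin (n + 1)} {η : EuclideanSpace ℝ (Fin (n + 1))}
    (hj : η j ≠ 0) : (graphLinear j η).normDet = ‖η‖ / |η j| := by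
  rw [← sq_eq_sq₀ (LinearMap.normDet_nonneg _) (by positivity)]
  have h := (graphLinear j η).normDet_sq_eq_det_gram (EuclideanSpace.basisFun (Fin n) ℝ)
  have hgram : Matrix.gram ℝ (fun i => graphLinear j η (EuclideanSpace.basisFun (Fin n) ℝ i)) =
      1 + Matrix.replicateCol Unit (fun i => η (j.succAbove i) / η j) *
        Matrix.replicateRow Unit (fun i => η (j.succAbove i) / η j) := by
    ext a b
    rw [Matrix.gram_apply, PiLp.inner_apply, Fin.sum_univ_succAbove _ j]
    simp [graphLinear, Matrix.mul_apply, Matrix.one_apply, Pi.single_apply]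
    ring_nf
  rw [hgram, Matrix.det_one_add_replicateCol_mul_replicateRow] at h
  rw [RCLike.ofReal_real_eq_id, id] at h
  rw [h, div_pow, sq_abs, EuclideanSpace.norm_sq_eq, Fin.sum_univ_succAbove _ j]
  simp only [dotProduct, Real.norm_eq_abs, sq_abs, add_div, Finset.sum_div]
  rw [div_self (by positivity)]
  congr 1
  refine Finset.sum_congr rfl fun i _ => ?_
  ring

theorem isVolumeChart_graphPoint {n : ℕ} {j : Fin (n + 1)} {η : EuclideanSpace ℝ (Fin (n + 1))}
    (hj : η j ≠ 0) : IsVolumeChart (fun y => WithLp.toLp 2 (graphPoint j η y)) (‖η‖ / |η j|) where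
  continuous := by
    refine (PiLp.continuous_toLp 2 _).comp ?_
    unfold graphPoint
    exact Continuous.finInsertNth j (by fun_prop) continuous_id
  injective y y' h := by
    ext i
    have := congrFun (WithLp.toLp_injective 2 h) (j.succAbove i)
    simpa [graphPoint] using this
  pos := by
    have : η ≠ 0 := fun h => hj (by simp [h])
    positivity
  volume_image s := by
    have h := (graphLinear j η).euclideanHausdorffMeasure_image_eq_normDet_mul_volume
      (WithLp.toLp 2 '' s)
    rw [finrank_euclideanSpace_fin, normDet_graphLinear hj] at h
    have h1 := (isVolumeChart_toLp n).volume_image s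
    rw [EuclideanSpace.euclideanHausdorffMeasure_eq_volume, ENNReal.ofReal_one, one_mul] at h1
    rw [h1] at h
    have hcomp : (fun y => WithLp.toLp 2 (graphPoint j η y)) =
        (fun v => WithLp.toLp 2 (graphPoint j η 0) +ᵥ v) ∘ graphLinear j η ∘ WithLp.toLp 2 :=
      funext fun y => toLp_graphPoint j η y
    rw [hcomp, Set.image_comp, Set.image_comp, Isometry.euclideanHausdorffMeasure_image
      (f := fun v => WithLp.toLp 2 (graphPoint j η 0) +ᵥ v) (isometry_vadd _ _), h]
  hullVolume_comp y := by
    have h : edgeMap (fun i => WithLp.toLp 2 (graphPoint j η (y i))) =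
        graphLinear j η ∘ₗ edgeMap (fun i => WithLp.toLp 2 (y i)) := by
      ext1 t
      simp only [edgeMap_apply, LinearMap.comp_apply, map_sum, map_smul, map_sub]
      refine Finset.sum_congr rfl fun i _ => ?_
      rw [toLp_graphPoint, toLp_graphPoint j _ (y 0)]
      simp
    rw [hullVolume_eq_normDet, h, LinearMap.normDet_comp_of_finrank_eq _ _ rfl,
      normDet_graphLinear hj, normDet_edgeMap_eq_abs_affDet, mul_div_assoc]

theorem range_graphPoint {n : ℕ} {j : Fin (n + 1)} {η : EuclideanSpace ℝ (Fin (n + 1))}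
    (hj : η j ≠ 0) :
    Set.range (fun y => WithLp.toLp 2 (graphPoint j η y)) = cartesianPlane η := by
  ext x
  simp only [cartesianPlane, Set.mem_range, Set.mem_ofPred_eq, PiLp.inner_apply,
    Fin.sum_univ_succAbove _ j]
  constructor
  · rintro ⟨y, rfl⟩
    simp [graphPoint]
    field_simp
    simp [mul_comm]
  · intro h
    refine ⟨fun i => x (j.succAbove i), ?_⟩
    ext l
    refine Fin.succAboveCases j ?_ (fun i => ?_) l
    · simp [graphPoint] at h ⊢
      field_simp
      rw [← h]
      simp [mul_comm]
    · simp [graphPoint]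

instance isFiniteMeasure_cond {Ω : Type*} [MeasurableSpace Ω] (μ : Measure Ω) (s : Set Ω) :
    IsFiniteMeasure (ProbabilityTheory.cond μ s) := by
  refine ⟨lt_of_le_of_lt ?_ ENNReal.one_lt_top⟩
  rw [ProbabilityTheory.cond, Measure.smul_apply, Measure.restrict_apply_univ, smul_eq_mul]
  exact ENNReal.inv_mul_le_one _

namespace IsVolumeChart

variable {p d : ℕ} {φ : (Fin p → ℝ) → EuclideanSpace ℝ (Fin d)} {C : ℝ}
  {M : Set (EuclideanSpace ℝ (Fin d))}

theorem measurableEmbedding (hφ : IsVolumeChart φ C) : MeasurableEmbedding φ :=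
  hφ.continuous.measurableEmbedding hφ.injective

theorem measurableEmbedding_pi (hφ : IsVolumeChart φ C) (m : ℕ) :
    MeasurableEmbedding fun (y : Fin m → Fin p → ℝ) i => φ (y i) := by
  refine Continuous.measurableEmbedding (continuous_pi fun i => hφ.continuous.comp
    (continuous_apply i)) fun y y' h => funext fun i => hφ.injective (congrFun h i)

theorem volume_eq (hφ : IsVolumeChart φ C) (hM : M ⊆ Set.range φ) :
    μHE[p] M = ENNReal.ofReal C * volume (φ ⁻¹' M) := by
  rw [← hφ.volume_image, Set.image_preimage_eq_of_subset hM]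

theorem volume_real_eq (hφ : IsVolumeChart φ C) (hM : M ⊆ Set.range φ) :
    μHE[p].real M = C * volume.real (φ ⁻¹' M) := by
  rw [measureReal_def, hφ.volume_eq hM, ENNReal.toReal_mul, ENNReal.toReal_ofReal hφ.pos.le]
  rfl

theorem unifMeasure_apply (hφ : IsVolumeChart φ C) (hM : M ⊆ Set.range φ)
    {s : Set (EuclideanSpace ℝ (Fin d))} (hs : MeasurableSet s) :
    unifMeasure p M s = (volume (φ ⁻¹' M))⁻¹ * volume (φ ⁻¹' M ∩ φ ⁻¹' s) := by
  have hC0 : ENNReal.ofReal C ≠ 0 := by simpa using hφ.pos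
  rw [unifMeasure, ProbabilityTheory.cond, Measure.smul_apply, Measure.restrict_apply hs,
    smul_eq_mul, hφ.volume_eq hM, hφ.volume_eq (Set.inter_subset_right.trans hM),
    ENNReal.mul_inv (Or.inl hC0) (Or.inl ENNReal.ofReal_ne_top), Set.preimage_inter,
    Set.inter_comm (φ ⁻¹' s)]
  rw [mul_mul_mul_comm, ENNReal.inv_mul_cancel hC0 ENNReal.ofReal_ne_top, one_mul]

/-- The constant `C` cancels in the normalisation, so uniform points of `M` are images of uniform
points of `φ ⁻¹' M`. -/
theorem sampleLaw_eq_map (hφ : IsVolumeChart φ C) (hM : M ⊆ Set.range φ)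
    (m : ℕ) :
    sampleLaw p m M = Measure.map (fun y i => φ (y i)) ((volume (φ ⁻¹' M))⁻¹ ^ (m + 1) •
      (volume.restrict (Set.univ.pi fun _ : Fin (m + 1) => φ ⁻¹' M))) := by
  have : IsFiniteMeasure (unifMeasure p M) := isFiniteMeasure_cond _ _
  refine Measure.pi_eq fun s hs => ?_
  rw [(hφ.measurableEmbedding_pi _).map_apply, Measure.smul_apply,
    Measure.restrict_apply ((hφ.measurableEmbedding_pi _).measurable (.univ_pi hs))]
  have : (fun (y : Fin (m + 1) → Fin p → ℝ) i => φ (y i)) ⁻¹' Set.univ.pi s ∩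
      (Set.univ.pi fun _ => φ ⁻¹' M) = Set.univ.pi fun i => φ ⁻¹' M ∩ φ ⁻¹' s i := by
    ext y
    simp [forall_and, and_comm]
  rw [this, volume_pi_pi, smul_eq_mul]
  simp_rw [hφ.unifMeasure_apply hM (hs _)]
  rw [Finset.prod_mul_distrib]
  simp

theorem integrable_hullVolume_rpow (hφ : IsVolumeChart φ C) (hM : M ⊆ Set.range φ)
    {k : ℝ} (hint : IntegrableOn (fun y => |affDet y| ^ k)
      (Set.univ.pi fun _ : Fin (p + 1) => φ ⁻¹' M)) :
    Integrable (fun X => hullVolume p p X ^ k) (sampleLaw p p M) := by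
  rw [hφ.sampleLaw_eq_map hM, (hφ.measurableEmbedding_pi _).integrable_map_iff]
  -- For a null section the scalar is `∞`, but the restricted measure is zero.
  by_cases h0 : volume (φ ⁻¹' M) = 0
  · have : volume.restrict (Set.univ.pi fun _ : Fin (p + 1) => φ ⁻¹' M) = 0 := by
      rw [Measure.restrict_eq_zero, volume_pi_pi]
      simp [h0]
    rw [this, smul_zero]
    exact integrable_zero_measure
  refine Integrable.smul_measure ?_ (by simp [h0])
  simp only [Function.comp_def, hφ.hullVolume_comp]
  have h1 : ∀ y : Fin (p + 1) → Fin p → ℝ, (C * (|affDet y| / p.factorial)) ^ k =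
      (C / p.factorial) ^ k * |affDet y| ^ k := by
    intro y
    rw [← Real.mul_rpow (div_nonneg hφ.pos.le (by positivity)) (abs_nonneg _)]
    ring_nf
  simp_rw [h1]
  exact Integrable.const_mul hint _

theorem volumetricMoment_eq (hφ : IsVolumeChart φ C) (hM : M ⊆ Set.range φ)
    (k : ℝ) :
    volumetricMoment p k M = ((p.factorial : ℝ) ^ k)⁻¹ * (volume.real (φ ⁻¹' M) ^ (p + 1))⁻¹ *
      (volume.real (φ ⁻¹' M) ^ k)⁻¹ *
      ∫ y in Set.univ.pi fun _ : Fin (p + 1) => φ ⁻¹' M, |affDet y| ^ k := by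
  rw [volumetricMoment, metricMoment, hφ.sampleLaw_eq_map hM,
    (hφ.measurableEmbedding_pi _).integral_map, integral_smul_measure, hφ.volume_real_eq hM,
    Real.mul_rpow hφ.pos.le measureReal_nonneg]
  have h1 : ∀ y : Fin (p + 1) → Fin p → ℝ, (C * (|affDet y| / p.factorial)) ^ k =
      C ^ k * ((p.factorial : ℝ) ^ k)⁻¹ * |affDet y| ^ k := by
    intro y
    rw [Real.mul_rpow hφ.pos.le (by positivity), Real.div_rpow (abs_nonneg _) (by positivity)]
    ring
  simp_rw [hφ.hullVolume_comp, h1]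
  rw [integral_const_mul, ENNReal.toReal_pow, ENNReal.toReal_inv, measureReal_def, smul_eq_mul]
  have : C ^ k ≠ 0 := (Real.rpow_pos_of_pos hφ.pos _).ne'
  rw [inv_pow]
  field_simp

end IsVolumeChart

/-! ### Absolute convergence on bounded sets -/

theorem integrableOn_abs_rpow_of_lintegral {α : Type*} [MeasurableSpace α] {μ : Measure α}
    {f : α → ℝ} (hf : Measurable f) {k : ℝ} {s : Set α} (h : ∫⁻ x in s, ‖f x‖ₑ ^ k ∂μ < ∞) :
    IntegrableOn (fun x => |f x| ^ k) s μ := by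
  refine ⟨(hf.abs.pow_const k).aestronglyMeasurable, lt_of_le_of_lt (lintegral_mono_ae ?_) h⟩
  have hfin := ae_lt_top (hf.enorm.pow_const k) h.ne
  filter_upwards [hfin] with x hx
  rw [Real.enorm_eq_ofReal (by positivity), Real.enorm_eq_ofReal_abs]
  -- At zeros of `f` with `k < 0` the real power is `0` and the extended one `∞`, so only an
  -- inequality holds.
  rcases eq_or_ne (f x) 0 with h0 | h0
  · rcases lt_trichotomy k 0 with hk | rfl | hk
    · simp [h0, hk.ne]
    · simp
    · simp [h0, hk.ne']
  · rw [ENNReal.ofReal_rpow_of_pos (abs_pos.2 h0)]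

theorem integrableOn_abs_affDet_rpow {p : ℕ} {k : ℝ} (hk : -1 < k) {T : Set (Fin p → ℝ)}
    (hT : Bornology.IsBounded T) :
    IntegrableOn (fun y => |affDet y| ^ k) (Set.univ.pi fun _ : Fin (p + 1) => T) := by
  obtain ⟨R, hR0, hR⟩ := hT.subset_closedBall_lt 0 0
  have hsub : (Set.univ.pi fun _ : Fin (p + 1) => T) ⊆ Metric.closedBall 0 R := by
    intro y hy
    rw [mem_closedBall_zero_iff, pi_norm_le_iff_of_nonneg hR0.le]
    exact fun i => by simpa using hR (hy i trivial)
  refine IntegrableOn.mono_set ?_ hsub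
  rcases lt_or_ge k 0 with hk0 | hk0
  · exact integrableOn_abs_rpow_of_lintegral measurable_affDet
      (lintegral_enorm_affDet_rpow_lt_top hk hk0 p R)
  · exact (continuous_affDet.abs.rpow_const fun _ => Or.inr hk0).continuousOn.integrableOn_compact
      (isCompact_closedBall _ _)

theorem integrableOn_abs_linear_rpow {n : ℕ} {k : ℝ} (hk : -1 < k) {T : Set (Fin (n + 1) → ℝ)}
    (hT : Bornology.IsBounded T) {η : Fin (n + 1) → ℝ} (hη : η ≠ 0) :
    IntegrableOn (fun x => |∑ i, η i * x i - 1| ^ k) T := by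
  obtain ⟨R, hR0, hR⟩ := hT.subset_closedBall_lt 0 0
  refine IntegrableOn.mono_set ?_ hR
  rcases lt_or_ge k 0 with hk0 | hk0
  · obtain ⟨j, hj⟩ := Function.ne_iff.1 hη
    obtain ⟨D, hD, h⟩ := exists_lintegral_enorm_linear_rpow_le hk hk0 n R
    refine integrableOn_abs_rpow_of_lintegral (by fun_prop) (lt_of_le_of_lt ?_
      (ENNReal.mul_lt_top hD.lt_top (b := ‖η j‖ₑ ^ k) ?_))
    · simpa [mul_comm, sub_eq_add_neg] using h η (-1) j
    · simp [ENNReal.rpow_eq_top_iff, lt_top_iff_ne_top, hk0.not_gt, show η j ≠ 0 from hj]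
  · have : Continuous fun x : Fin (n + 1) → ℝ => |∑ i, η i * x i - 1| ^ k :=
      Continuous.rpow_const (by fun_prop) fun _ => Or.inr hk0
    exact this.continuousOn.integrableOn_compact (isCompact_closedBall _ _)

theorem isBounded_graphPoint_preimage {n : ℕ} {S : Set (Fin (n + 1) → ℝ)}
    (hS : Bornology.IsBounded S) (j : Fin (n + 1)) (η : Fin (n + 1) → ℝ) :
    Bornology.IsBounded (graphPoint j η ⁻¹' S) := by
  obtain ⟨R, hR0, hR⟩ := hS.subset_closedBall_lt 0 0
  refine (Metric.isBounded_closedBall (x := (0 : Fin n → ℝ)) (r := R)).subset fun y hy => ?_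
  have h := hR hy
  rw [mem_closedBall_zero_iff, pi_norm_le_iff_of_nonneg hR0.le] at h ⊢
  intro i
  simpa [graphPoint] using h (j.succAbove i)

/-! ### Hyperplanes missing the body -/

theorem convex_polarBody {d : ℕ} (K : Set (EuclideanSpace ℝ (Fin d))) :
    Convex ℝ (polarBody K) := by
  intro x hx y hy a b ha hb hab z hz
  rw [inner_add_left, real_inner_smul_left, real_inner_smul_left]
  nlinarith [hx z hz, hy z hz]

/-- Some `t • η` with `t > 1` still lies in the polar body, which at a point of the section would
give `t ≤ 1`. -/
theorem section_eq_empty_of_mem_interior_polarBody {d : ℕ} {K : Set (EuclideanSpace ℝ (Fin d))}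
    {η : EuclideanSpace ℝ (Fin d)} (hη : η ∈ interior (polarBody K)) :
    cartesianPlane η ∩ K = ∅ := by
  refine Set.eq_empty_of_forall_notMem fun x hx => ?_
  have hcont : Filter.Tendsto (fun t : ℝ => t • η) (nhdsWithin 1 (Set.Ioi 1)) (nhds η) := by
    have : Continuous fun t : ℝ => t • η := by fun_prop
    simpa using (this.tendsto 1).mono_left nhdsWithin_le_nhds
  obtain ⟨t, ht, ht1⟩ := ((hcont.eventually (mem_interior_iff_mem_nhds.1 hη)).and
    self_mem_nhdsWithin).exists
  have h := ht x hx.2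
  rw [real_inner_smul_left, show inner ℝ η x = 1 from hx.1, mul_one] at h
  exact absurd h (not_le.2 ht1)

/-- The section may be nonempty for `η` on the boundary of the polar body, but the frontier of a
convex set is null. -/
theorem setIntegral_compl_polarBody {d : ℕ} (K : Set (EuclideanSpace ℝ (Fin d)))
    {f : EuclideanSpace ℝ (Fin d) → ℝ} (hf : ∀ η, cartesianPlane η ∩ K = ∅ → f η = 0) :
    ∫ η in (polarBody K)ᶜ, f η = ∫ η, f η := by
  refine setIntegral_eq_integral_of_ae_compl_eq_zero ?_
  have hfr : ∀ᵐ η, η ∉ frontier (polarBody K) :=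
    measure_eq_zero_iff_ae_notMem.1 ((convex_polarBody K).addHaar_frontier volume)
  filter_upwards [hfr] with η hη hmem
  refine hf η (section_eq_empty_of_mem_interior_polarBody ?_)
  rw [Set.mem_compl_iff, not_not] at hmem
  by_contra h
  exact hη ⟨subset_closure hmem, h⟩

/-! ### The section integrand and the final formula -/

theorem iota_eq {d : ℕ} (k : ℝ) (K : Set (EuclideanSpace ℝ (Fin d)))
    (η : EuclideanSpace ℝ (Fin d)) :
    iota k K η = ∫ x in WithLp.toLp 2 ⁻¹' K, |∑ i, η i * x i - 1| ^ k := by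
  have h := (EuclideanSpace.volume_preserving_symm_measurableEquiv_toLp (Fin d)).symm
    |>.setIntegral_preimage_emb (MeasurableEquiv.measurableEmbedding _)
    (fun x => |inner ℝ η x - 1| ^ k) K
  rw [iota, ← h]
  simp [PiLp.inner_apply, mul_comm]
  rfl

/-- The integrand of the section formula in graph coordinates. -/
theorem section_integrand_eq {n : ℕ} {K : Set (EuclideanSpace ℝ (Fin (n + 1)))} {k : ℝ}
    {η : EuclideanSpace ℝ (Fin (n + 1))} {j : Fin (n + 1)} (hj : η j ≠ 0)
    (hK : Bornology.IsBounded (WithLp.toLp 2 ⁻¹' K)) :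
    volumetricMoment n (k + 1) (cartesianPlane η ∩ K) * zeta K η ^ (((n + 1 : ℕ) : ℝ) + k + 1) *
      iota k K η = (((n.factorial : ℝ) ^ (k + 1))⁻¹ * (volume.real K ^ ((n : ℝ) + 2 + k))⁻¹) *
      ((|η j| ^ ((n : ℝ) + 2 + k))⁻¹ * ((∫ y in {y : Fin (n + 1) → Fin n → ℝ |
          ∀ i, graphPoint j η (y i) ∈ WithLp.toLp 2 ⁻¹' K}, |affDet y| ^ (k + 1)) *
        ∫ x in WithLp.toLp 2 ⁻¹' K, |∑ i, η i * x i - 1| ^ k)) := by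
  have hφ := isVolumeChart_graphPoint hj
  have hM : cartesianPlane η ∩ K ⊆ Set.range fun y => WithLp.toLp 2 (graphPoint j η y) := by
    rw [range_graphPoint hj]
    exact Set.inter_subset_left
  have hpre : (fun y => WithLp.toLp 2 (graphPoint j η y)) ⁻¹' (cartesianPlane η ∩ K) =
      graphPoint j η ⁻¹' (WithLp.toLp 2 ⁻¹' K) := by
    rw [Set.preimage_inter, ← range_graphPoint hj, Set.preimage_range, Set.univ_inter]
    rfl
  have hpi : {y : Fin (n + 1) → Fin n → ℝ | ∀ i, graphPoint j η (y i) ∈ WithLp.toLp 2 ⁻¹' K} =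
      Set.univ.pi fun _ => graphPoint j η ⁻¹' (WithLp.toLp 2 ⁻¹' K) := by
    ext y
    simp
  have hexp : (((n + 1 : ℕ) : ℝ) + k + 1) = (n : ℝ) + 2 + k := by push_cast; ring
  have hη : η ≠ 0 := fun h => hj (by simp [h])
  have hnorm : ‖η‖ ≠ 0 := norm_ne_zero_iff.2 hη
  rw [hφ.volumetricMoment_eq hM, zeta, show n + 1 - 1 = n from rfl, hφ.volume_real_eq hM, hpre,
    iota_eq, hpi, hexp]
  set V := volume.real (graphPoint j η ⁻¹' (WithLp.toLp 2 ⁻¹' K)) with hV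
  set G := ∫ y in Set.univ.pi fun _ : Fin (n + 1) => graphPoint j η ⁻¹' (WithLp.toLp 2 ⁻¹' K),
    |affDet y| ^ (k + 1) with hG
  -- The norm in `zeta` cancels the one in the scaling factor of the chart.
  have hz : ‖η‖ / |η j| * V / (‖η‖ * volume.real K) = V / (|η j| * volume.real K) := by
    field_simp
  rw [hz]
  rcases eq_or_ne V 0 with h0 | h0
  · have hG0 : G = 0 := by
      have hvol : volume (graphPoint j η ⁻¹' (WithLp.toLp 2 ⁻¹' K)) = 0 :=
        (measureReal_eq_zero_iff (isBounded_graphPoint_preimage hK j η).measure_lt_top.ne).1 h0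
      rw [hG, setIntegral_measure_zero]
      rw [volume_pi_pi]
      simp [hvol]
    rw [hG0]
    simp
  · have hVpos : 0 < V := lt_of_le_of_ne measureReal_nonneg (Ne.symm h0)
    rw [Real.div_rpow hVpos.le (by positivity), Real.mul_rpow (abs_nonneg _) measureReal_nonneg,
      -- The power of `V` from `zeta` cancels exactly the two normalisations in the moment.
      show V ^ ((n : ℝ) + 2 + k) = V ^ (n + 1) * V ^ (k + 1) by
        rw [← Real.rpow_natCast, ← Real.rpow_add hVpos]
        congr 1
        push_cast
        ring]
    have : V ^ (k + 1) ≠ 0 := (Real.rpow_pos_of_pos hVpos _).ne'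
    field_simp

theorem measurable_graph_coordinate_integrand {n : ℕ} (k : ℝ) {S : Set (Fin (n + 1) → ℝ)}
    (hS : MeasurableSet S) :
    Measurable fun η : Fin (n + 1) → ℝ => ENNReal.ofReal ((|η 0| ^ ((n : ℝ) + 2 + k))⁻¹) *
        ((∫⁻ y in {y : Fin (n + 1) → Fin n → ℝ | ∀ i, graphPoint 0 η (y i) ∈ S},
          ENNReal.ofReal (|affDet y| ^ (k + 1))) *
        ∫⁻ x in S, ENNReal.ofReal (|∑ i, η i * x i - 1| ^ k)) := by
  have haff := measurable_affDet (p := n)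
  have hgraph : Measurable fun q : (Fin (n + 1) → ℝ) × (Fin n → ℝ) => graphPoint 0 q.1 q.2 := by
    simp_rw [graphPoint_zero]
    exact measurable_fin_cons (by fun_prop) (by fun_prop)
  have hset : MeasurableSet {q : (Fin (n + 1) → ℝ) × (Fin (n + 1) → Fin n → ℝ) |
      ∀ i, graphPoint 0 q.1 (q.2 i) ∈ S} := by
    simp only [Set.ofPred_forall]
    refine MeasurableSet.iInter fun i => ?_
    exact (hgraph.comp (measurable_fst.prodMk ((measurable_pi_apply i).comp measurable_snd))) hS
  refine Measurable.mul (by fun_prop) (Measurable.mul ?_ ?_)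
  · have h : Measurable fun q : (Fin (n + 1) → ℝ) × (Fin (n + 1) → Fin n → ℝ) =>
        {q : (Fin (n + 1) → ℝ) × (Fin (n + 1) → Fin n → ℝ) |
          ∀ i, graphPoint 0 q.1 (q.2 i) ∈ S}.indicator
          (fun q => ENNReal.ofReal (|affDet q.2| ^ (k + 1))) q :=
      Measurable.indicator (by fun_prop) hset
    convert! h.lintegral_prod_right' (ν := volume) using 2 with η
    exact (lintegral_indicator (measurable_prodMk_left hset) _).symm
  · exact Measurable.lintegral_prod_right' (f := fun q : (Fin (n + 1) → ℝ) × (Fin (n + 1) → ℝ) =>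
      ENNReal.ofReal (|∑ i, q.1 i * q.2 i - 1| ^ k)) (by fun_prop)

theorem integral_toReal_ofReal {α : Type*} [MeasurableSpace α] {μ : Measure α} {f : α → ℝ}
    (hf : Measurable f) (k : ℝ) :
    (∫⁻ x, ENNReal.ofReal (|f x| ^ k) ∂μ).toReal = ∫ x, |f x| ^ k ∂μ :=
  (integral_eq_lintegral_of_nonneg_ae (Filter.Eventually.of_forall fun _ => by positivity)
    (hf.abs.pow_const k).aestronglyMeasurable).symm

theorem theorem1 (d : ℕ) (hd : 1 ≤ d) (K : ConvexBody (EuclideanSpace ℝ (Fin d)))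
    (hK : (interior (K : Set (EuclideanSpace ℝ (Fin d)))).Nonempty) (k : ℝ) (hk : -1 < k) :
    -- all the integrals involved converge absolutely
    Integrable (fun X => hullVolume d d X ^ k) (sampleLaw d d (K : Set (EuclideanSpace ℝ (Fin d)))) ∧
    (∀ η ∈ (polarBody (K : Set (EuclideanSpace ℝ (Fin d))))ᶜ,
      Integrable (fun X => hullVolume (d - 1) (d - 1) X ^ (k + 1))
        (sampleLaw (d - 1) (d - 1) (cartesianPlane η ∩ K))) ∧
    (∀ η ∈ (polarBody (K : Set (EuclideanSpace ℝ (Fin d))))ᶜ,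
      IntegrableOn (fun x => |inner ℝ η x - 1| ^ k) (K : Set (EuclideanSpace ℝ (Fin d)))) ∧
    IntegrableOn (fun η => volumetricMoment (d - 1) (k + 1) (cartesianPlane η ∩ K) *
        zeta K η ^ ((d : ℝ) + k + 1) * iota k K η)
      (polarBody (K : Set (EuclideanSpace ℝ (Fin d))))ᶜ ∧
    -- the canonical section integral
    volumetricMoment d k (K : Set (EuclideanSpace ℝ (Fin d))) =
      (Nat.factorial (d - 1) : ℝ) / (d : ℝ) ^ k *
        ∫ η in (polarBody (K : Set (EuclideanSpace ℝ (Fin d))))ᶜ,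
          volumetricMoment (d - 1) (k + 1) (cartesianPlane η ∩ K) *
            zeta K η ^ ((d : ℝ) + k + 1) * iota k K η := by
  obtain ⟨n, rfl⟩ : ∃ n, d = n + 1 := ⟨d - 1, by omega⟩
  set L : Set (EuclideanSpace ℝ (Fin (n + 1))) := (K : Set (EuclideanSpace ℝ (Fin (n + 1)))) with hL
  set S : Set (Fin (n + 1) → ℝ) := WithLp.toLp 2 ⁻¹' L with hSdef
  have hLm : MeasurableSet L := K.isCompact.isClosed.measurableSet
  have hSm : MeasurableSet S := (PiLp.continuous_toLp 2 _).measurable hLm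
  have hSb : Bornology.IsBounded S := by
    have : S = WithLp.ofLp '' L := by
      ext x
      exact ⟨fun h => ⟨_, h, rfl⟩, by rintro ⟨y, hy, rfl⟩; exact hy⟩
    rw [this]
    exact (K.isCompact.image (PiLp.continuous_ofLp 2 _)).isBounded
  have hchart := isVolumeChart_toLp (n + 1)
  have hrange : L ⊆ Set.range (WithLp.toLp 2 : (Fin (n + 1) → ℝ) → _) := fun x _ => ⟨x.ofLp, rfl⟩
  have hvol : volume.real L = volume.real S := by
    have := hchart.volume_real_eq hrange
    rwa [one_mul, EuclideanSpace.euclideanHausdorffMeasure_eq_volume] at this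
  have hint := integrableOn_abs_affDet_rpow hk hSb
  have hne : ∀ η ∈ (polarBody L)ᶜ, η ≠ 0 := by
    rintro η hη rfl
    exact hη fun y _ => by simp
  set c₀ : ℝ := ((n.factorial : ℝ) ^ (k + 1))⁻¹ * (volume.real L ^ ((n : ℝ) + 2 + k))⁻¹ with hc₀
  set g : (Fin (n + 1) → ℝ) → ℝ≥0∞ := fun η => ENNReal.ofReal ((|η 0| ^ ((n : ℝ) + 2 + k))⁻¹) *
        ((∫⁻ y in {y : Fin (n + 1) → Fin n → ℝ | ∀ i, graphPoint 0 η (y i) ∈ S},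
          ENNReal.ofReal (|affDet y| ^ (k + 1))) *
        ∫⁻ x in S, ENNReal.ofReal (|∑ i, η i * x i - 1| ^ k)) with hg
  have hgm : Measurable g := measurable_graph_coordinate_integrand k hSm
  have hJ : ∫⁻ X in Set.univ.pi (fun _ : Fin (n + 2) => S), ENNReal.ofReal (|affDet X| ^ k) =
      ∫⁻ η, g η := lintegral_pi_abs_affDet_rpow hk hSm
  have hJfin : ∫⁻ η, g η ≠ ∞ := by
    rw [← hJ]
    exact hint.lintegral_lt_top.ne
  have hJreal : (∫⁻ η, g η).toReal =
      ∫ X in Set.univ.pi (fun _ : Fin (n + 2) => S), |affDet X| ^ k := by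
    rw [← hJ, integral_toReal_ofReal measurable_affDet]
  set f : EuclideanSpace ℝ (Fin (n + 1)) → ℝ := fun η =>
    volumetricMoment n (k + 1) (cartesianPlane η ∩ L) *
        zeta L η ^ (((n + 1 : ℕ) : ℝ) + k + 1) * iota k L η with hf
  have hfg : (fun η => f (WithLp.toLp 2 η)) =ᵐ[volume] fun η => c₀ * (g η).toReal := by
    -- Charts over coordinate `0` suffice almost everywhere; the section moments, claimed integrable
    -- for every `η` outside the polar body, need a chart over an arbitrary `j`.
    have h0 : ∀ᵐ η : Fin (n + 1) → ℝ, η 0 ≠ 0 :=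
      Measure.ae_eval_ne (μ := fun _ => volume) 0 0
    filter_upwards [h0] with η hη
    have h := section_integrand_eq (K := L) (k := k) (η := WithLp.toLp 2 η) (j := 0) hη hSb
    simp only [hf, hg]
    rw [h, ENNReal.toReal_mul, ENNReal.toReal_mul, ENNReal.toReal_ofReal (by positivity),
      integral_toReal_ofReal measurable_affDet, integral_toReal_ofReal (by fun_prop)]
  have hmp := (EuclideanSpace.volume_preserving_symm_measurableEquiv_toLp (Fin (n + 1))).symm
  have hemb := (MeasurableEquiv.toLp 2 (Fin (n + 1) → ℝ)).measurableEmbedding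
  have hfint : Integrable f := by
    refine (hmp.integrable_comp_emb hemb).1 ?_
    exact ((integrable_toReal_of_lintegral_ne_top hgm.aemeasurable hJfin).const_mul c₀).congr
      hfg.symm
  have hfval : ∫ η, f η = c₀ * ∫ X in Set.univ.pi (fun _ : Fin (n + 2) => S), |affDet X| ^ k := by
    rw [← hmp.integral_comp hemb, ← hJreal, ← integral_toReal hgm.aemeasurable
      (ae_lt_top hgm hJfin), ← integral_const_mul]
    exact integral_congr_ae hfg
  refine ⟨hchart.integrable_hullVolume_rpow hrange hint, fun η hη => ?_, fun η hη => ?_,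
    hfint.integrableOn, ?_⟩
  · obtain ⟨j, hj⟩ : ∃ j, η j ≠ 0 := by
      by_contra! h
      exact hne η hη (PiLp.ext h)
    refine (isVolumeChart_graphPoint hj).integrable_hullVolume_rpow ?_
      (integrableOn_abs_affDet_rpow (by linarith) ?_)
    · rw [range_graphPoint hj]
      exact Set.inter_subset_left
    · refine (isBounded_graphPoint_preimage hSb j η).subset fun y hy => hy.2
  · have h := integrableOn_abs_linear_rpow hk hSb (η := η.ofLp) fun h => hne η hη
      (PiLp.ext fun i => congrFun h i)
    refine (hmp.integrableOn_comp_preimage hemb).1 ?_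
    convert! h using 2 with x
    simp [PiLp.inner_apply, mul_comm]
  · have hzero : ∀ η, cartesianPlane η ∩ L = ∅ → f η = 0 := by
      intro η h
      have hexp : ((n + 1 : ℕ) : ℝ) + k + 1 ≠ 0 := by
        have : (0 : ℝ) ≤ ((n + 1 : ℕ) : ℝ) := by positivity
        linarith
      have hz : zeta L η = 0 := by simp [zeta, h]
      simp only [hf, hz, Real.zero_rpow hexp, mul_zero, zero_mul]
    have hpolar := setIntegral_compl_polarBody L hzero
    change _ = (n.factorial : ℝ) / ((n + 1 : ℕ) : ℝ) ^ k * ∫ η in (polarBody L)ᶜ, f η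
    have hW : 0 < volume.real L := by
      rw [measureReal_def]
      exact ENNReal.toReal_pos
        ((isOpen_interior.measure_pos volume hK).trans_le (measure_mono interior_subset)).ne'
        K.isCompact.measure_lt_top.ne
    -- The prefactor is the quotient of `((n + 1)!) ^ (-k)` from the full simplex by `(n!) ^ (-(k +
    -- 1))` from the sections.
    rw [hpolar, hfval, hchart.volumetricMoment_eq hrange, ← hSdef, ← hvol, hc₀,
      Nat.factorial_succ, Nat.cast_mul, Real.mul_rpow (by positivity) (by positivity),
      Real.rpow_add_one (by positivity), show (n : ℝ) + 2 + k = ((n + 1 + 1 : ℕ) : ℝ) + k by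
        push_cast; ring, Real.rpow_add hW, Real.rpow_natCast]
    have : (n.factorial : ℝ) ^ k ≠ 0 := by positivity
    have : ((n + 1 : ℕ) : ℝ) ^ k ≠ 0 := by positivity
    field_simp
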